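/- Let $2^\omega$ be the set of all infinite sequences of $0$'s and $1$'s, with coordinatewise addition modulo $2$, and let $\mu$ be the Lebesgue measure on $2^\omega$, that is, the infinite product of the uniform probability measures on $\{0,1\}$. A set $A\subseteq 2^\omega$ (measurable or not) is null if it is contained in a measurable set of $\mu$-measure $0$. A set $X\subseteq 2^\omega$ is null-additive if for every null set $A\subseteq 2^\omega$ the set $X+A=\{x+a : x\in X,\ a\in A\}$ is null. Theorem. If the continuum hypothesis $2^{\aleph_0}=\aleph_1$ holds, then there is an uncountable null-additive set $X\subseteq 2^\omega$; indeed there is one of cardinality $\aleph_1$. -/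

import Mathlib

open scoped Pointwise Cardinal

/-- The Cantor space `2^ω`. Its addition is the coordinatewise addition modulo 2. -/
abbrev CantorSpace : Type := ℕ → ZMod 2

/-- The fair coin measure on the two-point set. -/
noncomputable def coinMeasure : MeasureTheory.Measure (ZMod 2) :=
  (PMF.uniformOfFintype (ZMod 2)).toMeasure

/-- The Lebesgue measure on `2^ω`: the infinite product of the fair coin measures. As a Mathlib
measure it is also defined, as an outer measure, on the non-measurable sets, so that
`cantorMeasure A = 0` says that `A` is contained in a measurable set of measure zero. -/
noncomputable def cantorMeasure : MeasureTheory.Measure CantorSpace :=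
  MeasureTheory.Measure.infinitePi (fun _ : ℕ => coinMeasure)

/-- `X` is null-additive if `X + A = {x + a : x ∈ X, a ∈ A}` is null for every null set `A`. -/
def NullAdditive (X : Set CantorSpace) : Prop :=
  ∀ A : Set CantorSpace, cantorMeasure A = 0 → cantorMeasure (X + A) = 0

open MeasureTheory Filter Set
open scoped ENNReal Topology

/-! ### Translation invariance of the coin measure on Cantor space -/

/-! Under CH the measurable null sets can be listed along `ω₁`. Build a tower of infinite sets `H i`
of naturals, strictly decreasing modulo finite, with `H i` so sparse that adding all sequences
supported on `H i` to the `i`-th null set leaves it null. The indicators of the `H i` form `X`.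
Given a null `A` contained in the `i`-th set, the indicators before stage `i` give countably many
translates of `A`; the later ones are supported on `H i` up to finitely many coordinates, so they
give only countably many translates of one null set.

Sparseness suffices because an open cover of `A` splits into pieces depending on finitely many
coordinates, and on a piece depending on the first `m` the sequences supported on `H` act as only `2
^ |H ∩ m|` translations. -/

instance isProbabilityMeasure_coinMeasure : IsProbabilityMeasure coinMeasure := by
  unfold coinMeasure; infer_instance

instance isProbabilityMeasure_cantorMeasure : IsProbabilityMeasure cantorMeasure := by
  unfold cantorMeasure; infer_instance

instance borelSpace_zmod_two : BorelSpace (ZMod 2) :=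
  ⟨(borel_eq_top_of_discrete).symm⟩

theorem coinMeasure_singleton (a : ZMod 2) : coinMeasure {a} = 2⁻¹ := by
  rw [coinMeasure, PMF.toMeasure_apply_singleton _ _ (measurableSet_singleton a)]
  simp

theorem coinMeasure_map_add_left (a : ZMod 2) : coinMeasure.map (a + ·) = coinMeasure := by
  refine Measure.ext_of_singleton fun b => ?_
  rw [Measure.map_apply (measurable_of_finite _) (measurableSet_singleton b)]
  have : (a + ·) ⁻¹' ({b} : Set (ZMod 2)) = {b - a} := by
    ext x
    simp only [mem_preimage, mem_singleton_iff, eq_sub_iff_add_eq, add_comm]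
  rw [this, coinMeasure_singleton, coinMeasure_singleton]

theorem cantorMeasure_map_add_left (a : CantorSpace) :
    cantorMeasure.map (a + ·) = cantorMeasure := by
  have h := Measure.infinitePi_map_pi (μ := fun _ : ℕ => coinMeasure)
    (f := fun n x => a n + x) (fun _ => measurable_of_finite _)
  simp only [coinMeasure_map_add_left] at h
  exact h

theorem measurable_cantor_add_left (a : CantorSpace) : Measurable (a + · : CantorSpace → _) :=
  measurable_pi_lambda _ fun n =>
    (measurable_of_finite fun x : ZMod 2 => a n + x).comp (measurable_pi_apply n)

theorem cantorMeasure_preimage_add_left (a : CantorSpace) (s : Set CantorSpace) :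
    cantorMeasure ((a + ·) ⁻¹' s) = cantorMeasure s := by
  have e : MeasurableEmbedding (a + · : CantorSpace → CantorSpace) :=
    (MeasurableEquiv.mk (Equiv.addLeft a) (measurable_cantor_add_left a)
      (measurable_cantor_add_left (-a))).measurableEmbedding
  conv_rhs => rw [← cantorMeasure_map_add_left a]
  exact (e.map_apply _ _).symm

theorem cantorMeasure_singleton_add (a : CantorSpace) (s : Set CantorSpace) :
    cantorMeasure ({a} + s) = cantorMeasure s := by
  rw [singleton_add, image_add_left, cantorMeasure_preimage_add_left]

theorem cantorMeasure_countable_add_eq_zero {C A : Set CantorSpace} (hC : C.Countable)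
    (hA : cantorMeasure A = 0) : cantorMeasure (C + A) = 0 := by
  rw [← biUnion_of_singleton C, iUnion₂_add, measure_biUnion_null_iff hC]
  intro c _
  rw [cantorMeasure_singleton_add, hA]

/-! ### Sets of sequences supported on a set of coordinates -/

/-- The set of the sequences that vanish outside `H`. -/
def supportedOn (H : Set ℕ) : Set CantorSpace := {x | ∀ n, n ∉ H → x n = 0}

/-- The set of the members of `H` below `m`. -/
noncomputable def membersBelow (H : Set ℕ) (m : ℕ) : Finset ℕ :=
  ((finite_lt_nat m).inter_of_right H).toFinset

theorem mem_membersBelow {H : Set ℕ} {m n : ℕ} : n ∈ membersBelow H m ↔ n ∈ H ∧ n < m := by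
  simp [membersBelow]

/-- Membership in `C` depends only on the first `m` coordinates. -/
def DependsOnFirst (C : Set CantorSpace) (m : ℕ) : Prop :=
  ∀ x ∈ C, ∀ y ∈ PiNat.cylinder x m, y ∈ C

theorem DependsOnFirst.measurableSet {C : Set CantorSpace} {m : ℕ} (hC : DependsOnFirst C m) :
    MeasurableSet C := by
  have : C = ⋃ x ∈ C, PiNat.cylinder x m := by
    ext y
    simp only [mem_iUnion]
    exact ⟨fun hy => ⟨y, hy, PiNat.self_mem_cylinder y m⟩, fun ⟨x, hx, hy⟩ => hC x hx y hy⟩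
  rw [this]
  exact (isOpen_biUnion fun x _ => PiNat.isOpen_cylinder _ x m).measurableSet

/-- Only the first `m` coordinates of the translating sequence matter, and on these it agrees with
the indicator of a subset of `H ∩ m`. -/
theorem DependsOnFirst.cantorMeasure_supportedOn_add_le {C : Set CantorSpace} {m : ℕ}
    (hC : DependsOnFirst C m) (H : Set ℕ) :
    cantorMeasure (supportedOn H + C) ≤ 2 ^ (membersBelow H m).card * cantorMeasure C := by
  classical
  have hsub : supportedOn H + C ⊆
      ⋃ s ∈ (membersBelow H m).powerset, ({indicator (s : Set ℕ) 1} + C : Set CantorSpace) := by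
    rintro _ ⟨x, hx, c, hc, rfl⟩
    simp only [mem_iUnion]
    refine ⟨(membersBelow H m).filter (fun n => x n = 1), by simp, ?_⟩
    set e : CantorSpace :=
      indicator (((membersBelow H m).filter (fun n => x n = 1) : Finset ℕ) : Set ℕ) 1 with he
    refine ⟨e, rfl, x + c - e, hC c hc _ fun n hn => ?_, by simp⟩
    have : e n = x n := by
      by_cases h1 : x n = 1
      · have hH : n ∈ H := by
          by_contra h
          exact one_ne_zero (h1.symm.trans (hx n h))
        rw [he, indicator_of_mem] <;> simp [mem_membersBelow, h1, hH, hn]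
      · have h0 : x n = 0 := by
          generalize x n = a at h1
          revert a; decide
        rw [he, indicator_of_notMem] <;> simp [h0]
    simp [this]
  calc cantorMeasure (supportedOn H + C)
      ≤ ∑ s ∈ (membersBelow H m).powerset,
          cantorMeasure ({indicator (s : Set ℕ) 1} + C : Set CantorSpace) :=
        (measure_mono hsub).trans (measure_biUnion_finset_le _ _)
    _ = 2 ^ (membersBelow H m).card * cantorMeasure C := by
        simp only [cantorMeasure_singleton_add, Finset.sum_const, Finset.card_powerset,
          nsmul_eq_mul, Nat.cast_pow, Nat.cast_ofNat]

/-- An open subset of Cantor space is a disjoint union of sets, the `m`-th of which depends only on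
the first `m` coordinates. -/
theorem exists_disjoint_iUnion_dependsOnFirst {U : Set CantorSpace} (hU : IsOpen U) :
    ∃ C : ℕ → Set CantorSpace, (∀ m, DependsOnFirst (C m) m) ∧ ⋃ m, C m = U ∧
      Pairwise (Function.onFun Disjoint C) := by
  let V : ℕ → Set CantorSpace := fun m => {x | PiNat.cylinder x m ⊆ U}
  refine ⟨disjointed V, fun m x hx y hy => ?_, ?_, disjoint_disjointed V⟩
  · rw [disjointed_eq_inter_compl] at hx ⊢
    simp only [mem_inter_iff, mem_iInter, mem_compl_iff] at hx ⊢
    -- Points with the same first `m` coordinates have the same `j`-cylinders for `j ≤ m`, so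
    -- disjointing preserves the dependence.
    have key : ∀ j ≤ m, (y ∈ V j ↔ x ∈ V j) := fun j hj => by
      have := PiNat.mem_cylinder_iff_eq.1 (PiNat.cylinder_anti x hj hy)
      simp only [V, mem_ofPred_eq, this]
    exact ⟨(key m le_rfl).2 hx.1, fun j hj h => hx.2 j hj ((key j hj.le).1 h)⟩
  · rw [iUnion_disjointed]
    ext x
    simp only [mem_iUnion]
    refine ⟨fun ⟨m, hm⟩ => hm (PiNat.self_mem_cylinder x m), fun hx => ?_⟩
    obtain ⟨_, ⟨z, m, rfl⟩, hxz, hzU⟩ :=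
      (PiNat.isTopologicalBasis_cylinders (fun _ : ℕ => ZMod 2)).exists_subset_of_mem_open hx hU
    refine ⟨m, ?_⟩
    change PiNat.cylinder x m ⊆ U
    rwa [PiNat.mem_cylinder_iff_eq.1 hxz]

/-! ### Sparse sets of coordinates -/

theorem two_pow_eq_one_add_sum_range (j : ℕ) :
    (2 : ℝ≥0∞) ^ j = 1 + ∑ k ∈ Finset.range j, 2 ^ k := by
  induction j with
  | zero => simp
  | succ j ih => rw [Finset.sum_range_succ, ← add_assoc, ← ih, pow_succ, mul_two]

theorem tsum_indicator_Ici (c : ℕ → ℝ≥0∞) (N : ℕ) :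
    ∑' m, (Ici N).indicator c m = ∑' m, c (m + N) := by
  have h := Summable.sum_add_tsum_nat_add' (f := (Ici N).indicator c) (k := N) ENNReal.summable
  rw [Finset.sum_eq_zero fun m hm => indicator_of_notMem (by simpa using hm) _, zero_add] at h
  rw [← h]
  exact tsum_congr fun m => indicator_of_mem (mem_Ici.2 (Nat.le_add_left N m)) c

/-- For a summable `c`, every infinite set has an infinite, co-infinite subset `H` so sparse that
`2 ^ |H ∩ m| * c m` is still summable. -/
theorem exists_sparse_subset {c : ℕ → ℝ≥0∞} (hc : ∑' m, c m ≠ ∞) {K : Set ℕ} (hK : K.Infinite) :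
    ∃ H ⊆ K, H.Infinite ∧ (K \ H).Infinite ∧
      ∑' m, 2 ^ (membersBelow H m).card * c m ≠ ∞ := by
  have htail : ∀ k : ℕ, ∀ᶠ N in atTop, ∑' m, c (m + N) < (4⁻¹ : ℝ≥0∞) ^ k := fun k =>
    (ENNReal.tendsto_sum_nat_add c hc).eventually_lt_const
      (ENNReal.pow_pos (by simp) k)
  -- Even-indexed terms will form `H`; odd-indexed ones keep `K \ H` infinite.
  obtain ⟨φ, hφ, hφP⟩ := extraction_forall_of_frequently
    (P := fun k n => n ∈ K ∧ ∑' m, c (m + n) < (4⁻¹ : ℝ≥0∞) ^ k)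
    fun k => (Nat.frequently_atTop_iff_infinite.2 hK).and_eventually (htail k)
  have hφ2 : StrictMono fun k => φ (2 * k) := fun a b h => hφ (by omega)
  have hφ1 : StrictMono fun k => φ (2 * k + 1) := fun a b h => hφ (by omega)
  refine ⟨range fun k => φ (2 * k), ?_, infinite_range_of_injective hφ2.injective,
    (infinite_range_of_injective hφ1.injective).mono ?_, ?_⟩
  · rintro _ ⟨k, rfl⟩; exact (hφP _).1
  · rintro _ ⟨k, rfl⟩
    refine ⟨(hφP _).1, ?_⟩
    rintro ⟨j, hj⟩
    have := hφ.injective hj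
    omega
  set H := range fun k => φ (2 * k) with hH
  have hcard : ∀ m k, k < (membersBelow H m).card → φ (2 * k) < m := by
    intro m k hk
    by_contra hle
    have hsub : membersBelow H m ⊆ (Finset.range k).image fun k => φ (2 * k) := by
      intro n hn
      obtain ⟨⟨j, rfl⟩, hjm⟩ := mem_membersBelow.1 hn
      have : j < k := hφ2.lt_iff_lt.1 (lt_of_lt_of_le hjm (not_lt.1 hle))
      exact Finset.mem_image.2 ⟨j, Finset.mem_range.2 this, rfl⟩
    have := (Finset.card_le_card hsub).trans Finset.card_image_le
    rw [Finset.card_range] at this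
    omega
  -- The summand `2 ^ k` occurs only when `φ (2 * k) < m`, so summing over `m` first leaves `2 ^ k`
  -- times a tail of `c`, at most `2⁻¹ ^ k`.
  have hbound : ∀ m, 2 ^ (membersBelow H m).card * c m ≤
      c m + ∑' k, 2 ^ k * (Ici (φ (2 * k))).indicator c m := by
    intro m
    rw [two_pow_eq_one_add_sum_range, add_mul, one_mul, Finset.sum_mul]
    gcongr
    refine (Finset.sum_le_sum fun k hk => ?_).trans (ENNReal.sum_le_tsum _)
    rw [indicator_of_mem (mem_Ici.2 (hcard m k (Finset.mem_range.1 hk)).le)]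
  refine ne_top_of_le_ne_top ?_ (ENNReal.tsum_le_tsum hbound)
  rw [ENNReal.tsum_add, ENNReal.tsum_comm]
  refine ENNReal.add_ne_top.2 ⟨hc, ?_⟩
  have hk : ∀ k, ∑' m, 2 ^ k * (Ici (φ (2 * k))).indicator c m ≤ (2⁻¹ : ℝ≥0∞) ^ k := by
    intro k
    rw [ENNReal.tsum_mul_left]
    rw [tsum_indicator_Ici]
    calc (2 : ℝ≥0∞) ^ k * ∑' m, c (m + φ (2 * k)) ≤ 2 ^ k * 4⁻¹ ^ k := by
          gcongr
          refine (hφP (2 * k)).2.le.trans (pow_le_pow_right_of_le_one' ?_ (by omega))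
          exact ENNReal.inv_le_one.2 (by norm_num)
      _ = 2⁻¹ ^ k := by
          rw [← mul_pow]
          congr 1
          rw [show (4 : ℝ≥0∞) = 2 * 2 by norm_num,
            ENNReal.mul_inv (by simp) (by simp), ← mul_assoc,
            ENNReal.mul_inv_cancel (by simp) (by simp), one_mul]
  refine ne_top_of_le_ne_top ?_ (ENNReal.tsum_le_tsum hk)
  rw [ENNReal.tsum_geometric]
  simp

/-- Every infinite set of coordinates has an infinite, co-infinite subset `H` such that the
translates of a given null set by the sequences supported on `H` have a null union. -/
theorem exists_subset_supportedOn_add_null {A : Set CantorSpace} (hA : cantorMeasure A = 0)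
    {K : Set ℕ} (hK : K.Infinite) :
    ∃ H ⊆ K, H.Infinite ∧ (K \ H).Infinite ∧ cantorMeasure (supportedOn H + A) = 0 := by
  have hU : ∀ k : ℕ, ∃ U ⊇ A, IsOpen U ∧ cantorMeasure U < (2⁻¹ : ℝ≥0∞) ^ k := fun k =>
    A.exists_isOpen_lt_of_lt _ (by rw [hA]; exact ENNReal.pow_pos (by simp) k)
  choose U hAU hUo hUm using hU
  choose C hCdep hCU hCdisj using fun k => exists_disjoint_iUnion_dependsOnFirst (hUo k)
  have hsum : ∀ k, ∑' m, cantorMeasure (C k m) = cantorMeasure (U k) := fun k => by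
    rw [← hCU k, measure_iUnion (hCdisj k) fun m => (hCdep k m).measurableSet]
  -- Summing over all the covers lets one `H` serve every `k`; the bounds for the `k`-th cover are
  -- then summable, hence tend to `0`.
  have hc : ∑' m, ∑' k, cantorMeasure (C k m) ≠ ∞ := by
    rw [ENNReal.tsum_comm]
    simp only [hsum]
    refine ne_top_of_le_ne_top ?_ (ENNReal.tsum_le_tsum fun k => (hUm k).le)
    rw [ENNReal.tsum_geometric]
    simp
  obtain ⟨H, hHK, hH, hKH, hHsum⟩ := exists_sparse_subset hc hK
  refine ⟨H, hHK, hH, hKH, ?_⟩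
  simp only [← ENNReal.tsum_mul_left] at hHsum
  rw [ENNReal.tsum_comm] at hHsum
  refine le_antisymm (ge_of_tendsto' (ENNReal.tendsto_atTop_zero_of_tsum_ne_top hHsum)
    fun k => ?_) zero_le
  calc cantorMeasure (supportedOn H + A)
      ≤ cantorMeasure (⋃ m, (supportedOn H + C k m)) := by
        rw [← add_iUnion, hCU]
        exact measure_mono (add_subset_add_left (hAU k))
    _ ≤ ∑' m, cantorMeasure (supportedOn H + C k m) := measure_iUnion_le _
    _ ≤ _ := ENNReal.tsum_le_tsum fun m => (hCdep k m).cantorMeasure_supportedOn_add_le H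

/-! ### Towers of infinite sets -/

/-- A countable family of infinite sets of naturals, directed with respect to almost inclusion, has
an infinite pseudo-intersection. -/
theorem exists_infinite_pseudoIntersection {ι : Type*} [Countable ι] (F : ι → Set ℕ)
    (hinf : ∀ i, (F i).Infinite)
    (hdir : ∀ i j, ∃ k, (F k \ F i).Finite ∧ (F k \ F j).Finite) :
    ∃ K : Set ℕ, K.Infinite ∧ ∀ i, (K \ F i).Finite := by
  rcases isEmpty_or_nonempty ι with _ | _
  · exact ⟨univ, infinite_univ, fun i => isEmptyElim i⟩
  have hle : ∀ k i, (F k \ F i).Finite → cofinite ⊓ 𝓟 (F k) ≤ cofinite ⊓ 𝓟 (F i) := by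
    intro k i h
    refine le_inf inf_le_left (le_principal_iff.2 ?_)
    rw [mem_inf_principal, mem_cofinite]
    convert h using 1
    ext n; simp
  have hdir' : Directed (· ≥ ·) fun i => (cofinite ⊓ 𝓟 (F i) : Filter ℕ) := fun i j =>
    let ⟨k, h1, h2⟩ := hdir i j
    ⟨k, hle k i h1, hle k j h2⟩
  -- A sequence converging to this filter has the desired range: the `cofinite` part makes it
  -- infinite, the principal parts almost contained in each `F i`.
  have hne : (⨅ i, (cofinite ⊓ 𝓟 (F i) : Filter ℕ)).NeBot :=
    iInf_neBot_of_directed' hdir' fun i => (hinf i).cofinite_inf_principal_neBot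
  have hcg : (cofinite : Filter ℕ).IsCountablyGenerated := by
    rw [Nat.cofinite_eq_atTop]; infer_instance
  obtain ⟨u, hu⟩ := exists_seq_tendsto (⨅ i, (cofinite ⊓ 𝓟 (F i) : Filter ℕ))
  have hu' : ∀ i, Tendsto u atTop (cofinite ⊓ 𝓟 (F i)) := fun i => hu.mono_right (iInf_le _ i)
  refine ⟨range u, fun hfin => ?_, fun i => ?_⟩
  · have h := ((hu' (Classical.arbitrary ι)).mono_right inf_le_left).eventually
      hfin.compl_mem_cofinite
    obtain ⟨n, hn⟩ := h.exists
    exact hn (mem_range_self n)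
  · have h := tendsto_principal.1 ((hu' i).mono_right inf_le_right)
    rw [← Nat.cofinite_eq_atTop, eventually_cofinite] at h
    refine (h.image u).subset ?_
    rintro _ ⟨⟨n, rfl⟩, hn⟩
    exact ⟨n, hn, rfl⟩

/-- Along a well-order with countable initial segments one can build a tower of infinite sets of
naturals, strictly decreasing modulo finite, that meets a given density requirement at each step. -/
theorem exists_tower {ι : Type*} [LinearOrder ι] [WellFoundedLT ι]
    (hcount : ∀ i : ι, (Iio i).Countable) (Q : ι → Set ℕ → Prop)
    (hQ : ∀ i, ∀ K : Set ℕ, K.Infinite → ∃ H ⊆ K, H.Infinite ∧ (K \ H).Infinite ∧ Q i H) :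
    ∃ H : ι → Set ℕ, (∀ i, Q i (H i)) ∧
      ∀ i, ∀ j < i, (H i \ H j).Finite ∧ (H j \ H i).Infinite := by
  classical
  let Good : (i : ι) → ((j : ι) → j < i → Set ℕ) → Set ℕ → Prop := fun i f K =>
    K.Infinite ∧ Q i K ∧ ∀ j (hj : j < i), (K \ f j hj).Finite ∧ (f j hj \ K).Infinite
  let step : (i : ι) → ((j : ι) → j < i → Set ℕ) → Set ℕ := fun i f =>
    -- The default `∅` is never reached, by `hgood`.
    if h : ∃ K, Good i f K then h.choose else ∅
  let H : ι → Set ℕ := wellFounded_lt.fix step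
  have hH : ∀ i, H i = step i fun j _ => H j := fun i => wellFounded_lt.fix_eq step i
  have hgood : ∀ i, Good i (fun j _ => H j) (H i) := by
    intro i
    induction i using WellFoundedLT.induction with
    | ind i ih =>
      have hex : ∃ K, Good i (fun j _ => H j) K := by
        have : Countable (Iio i) := (hcount i).to_subtype
        have hmono : ∀ j k : Iio i, j ≤ k → (H k \ H j).Finite := by
          intro j k hjk
          rcases hjk.eq_or_lt with rfl | h
          · simp
          · exact ((ih k k.2).2.2 j h).1
        obtain ⟨K, hKinf, hK⟩ := exists_infinite_pseudoIntersection (fun j : Iio i => H j)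
          (fun j => (ih j j.2).1)
          (fun j k => ⟨max j k, hmono _ _ (le_max_left _ _), hmono _ _ (le_max_right _ _)⟩)
        obtain ⟨L, hLK, hL, hKL, hQL⟩ := hQ i K hKinf
        refine ⟨L, hL, hQL, fun j hj => ⟨(hK ⟨j, hj⟩).subset (sdiff_subset_sdiff_left hLK), ?_⟩⟩
        refine (hKL.sdiff (hK ⟨j, hj⟩)).mono ?_
        rintro n ⟨⟨h1, h2⟩, h3⟩
        exact ⟨by_contra fun h => h3 ⟨h1, h⟩, h2⟩
      have : H i = hex.choose := by rw [hH]; exact dif_pos hex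
      rw [this]
      exact hex.choose_spec
  exact ⟨H, fun i => (hgood i).2.1, fun i => (hgood i).2.2⟩

/-! ### Null-additive sets -/

/-- The indicator of a set almost contained in `H` is a sequence supported on `H` up to a finitely
supported one. -/
theorem indicator_mem_finite_add_supportedOn {H L : Set ℕ} (h : (L \ H).Finite) :
    (indicator L 1 : CantorSpace) ∈
      range (fun s : Finset ℕ => (indicator (s : Set ℕ) 1 : CantorSpace)) + supportedOn H := by
  refine ⟨_, ⟨h.toFinset, rfl⟩, indicator (L ∩ H) 1, fun n hn => ?_, ?_⟩
  · exact indicator_of_notMem (fun h => hn h.2) _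
  · ext n
    by_cases h1 : n ∈ L <;> by_cases h2 : n ∈ H <;> simp [h1, h2]

theorem nullAdditive_range_indicator_tower {ι : Type*} [LinearOrder ι]
    (hcount : ∀ i : ι, (Iio i).Countable) {H : ι → Set ℕ}
    (htower : ∀ i, ∀ j < i, (H i \ H j).Finite)
    (hnull : ∀ A, cantorMeasure A = 0 → ∃ i, cantorMeasure (supportedOn (H i) + A) = 0) :
    NullAdditive (range fun i => (indicator (H i) 1 : CantorSpace)) := by
  intro A hA
  obtain ⟨i, hi⟩ := hnull A hA
  set x : ι → CantorSpace := fun i => indicator (H i) 1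
  set D : Set CantorSpace := range fun s : Finset ℕ => indicator (s : Set ℕ) 1
  have hsub : range x + A ⊆ (x '' Iio i + A) ∪ (D + (supportedOn (H i) + A)) := by
    rintro _ ⟨_, ⟨j, rfl⟩, a, ha, rfl⟩
    rcases lt_or_ge j i with hj | hj
    · exact Or.inl (add_mem_add (mem_image_of_mem x hj) ha)
    · refine Or.inr ?_
      rw [← add_assoc]
      refine add_mem_add (indicator_mem_finite_add_supportedOn ?_) ha
      rcases hj.eq_or_lt with rfl | hj
      · simp
      · exact htower j i hj
  refine measure_mono_null hsub (measure_union_null ?_ ?_)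
  · exact cantorMeasure_countable_add_eq_zero ((hcount i).image x) hA
  · exact cantorMeasure_countable_add_eq_zero (countable_range _) hi

/-- There are too many null sets to list along `ω₁`, but each lies in a measurable one. -/
theorem mk_measurableSet_cantorSpace_le :
    Cardinal.mk {s : Set CantorSpace // MeasurableSet s} ≤ Cardinal.continuum := by
  obtain ⟨b, hb, hgen⟩ := MeasurableSpace.CountablyGenerated.isCountablyGenerated
    (α := CantorSpace)
  rw [hgen]
  exact MeasurableSpace.cardinal_measurableSet_le_continuum
    (hb.le_aleph0.trans Cardinal.aleph0_le_continuum)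

/-- If the continuum hypothesis holds, there is an uncountable null-additive subset of `2^ω`,
of cardinality `ℵ₁`. -/
theorem theorem19 (CH : Cardinal.continuum.{0} = Cardinal.aleph.{0} 1) :
    ∃ X : Set CantorSpace,
      ¬ X.Countable ∧ Cardinal.mk X = Cardinal.aleph.{0} 1 ∧ NullAdditive X := by
  let ι : Type := (Cardinal.aleph.{0} 1).ord.ToType
  have hι : Cardinal.mk ι = Cardinal.aleph 1 := Cardinal.mk_ord_toType _
  have hcount : ∀ i : ι, (Iio i).Countable := fun i => by
    rw [← Cardinal.le_aleph0_iff_set_countable, ← Cardinal.lt_aleph_one_iff]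
    simpa [hι] using Cardinal.mk_Iio_lt i (by simp [ι])
  have hle : Cardinal.mk {s : Set CantorSpace // MeasurableSet s} ≤ Cardinal.mk ι := by
    rw [hι, ← CH]; exact mk_measurableSet_cantorSpace_le
  have : Nonempty {s : Set CantorSpace // MeasurableSet s} := ⟨⟨∅, .empty⟩⟩
  obtain ⟨g⟩ := hle
  have he : Function.Surjective (Function.invFun g) := Function.invFun_surjective g.injective
  set e : ι → {s : Set CantorSpace // MeasurableSet s} := Function.invFun g
  obtain ⟨H, hHQ, hH⟩ := exists_tower hcount
    (fun i L => cantorMeasure (e i : Set CantorSpace) = 0 →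
      cantorMeasure (supportedOn L + (e i : Set CantorSpace)) = 0) <| by
    intro i K hK
    by_cases h0 : cantorMeasure (e i : Set CantorSpace) = 0
    · obtain ⟨L, h1, h2, h3, h4⟩ := exists_subset_supportedOn_add_null h0 hK
      exact ⟨L, h1, h2, h3, fun _ => h4⟩
    -- The requirement is vacuous here; the empty null set still yields an infinite, co-infinite
    -- subset.
    · obtain ⟨L, h1, h2, h3, -⟩ := exists_subset_supportedOn_add_null measure_empty hK
      exact ⟨L, h1, h2, h3, fun h => absurd h h0⟩
  have hne : ∀ i j, j < i → (indicator (H i) 1 : CantorSpace) ≠ indicator (H j) 1 := by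
    intro i j hj h
    obtain ⟨n, hn1, hn2⟩ := (hH i j hj).2.nonempty
    have := congrFun h n
    simp [hn1, hn2] at this
  have hinj : Function.Injective fun i => (indicator (H i) 1 : CantorSpace) := by
    intro i j h
    rcases lt_trichotomy i j with hij | hij | hij
    · exact absurd h.symm (hne j i hij)
    · exact hij
    · exact absurd h (hne i j hij)
  have hcard : Cardinal.mk (range fun i => (indicator (H i) 1 : CantorSpace)) =
      Cardinal.aleph 1 := by
    rw [Cardinal.mk_range_eq _ hinj, hι]
  refine ⟨_, fun hX => ?_, hcard, nullAdditive_range_indicator_tower hcount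
    (fun i j hj => (hH i j hj).1) fun A hA => ?_⟩
  · rw [← Cardinal.le_aleph0_iff_set_countable, hcard] at hX
    exact absurd hX (not_le.2 Cardinal.aleph0_lt_aleph_one)
  · obtain ⟨i, hi⟩ := he ⟨toMeasurable cantorMeasure A, measurableSet_toMeasurable _ _⟩
    have hi' : (e i : Set CantorSpace) = toMeasurable cantorMeasure A := congrArg Subtype.val hi
    have h0 := hHQ i (by rw [hi', measure_toMeasurable, hA])
    refine ⟨i, measure_mono_null (add_subset_add_left ?_) h0⟩
    rw [hi']
    exact subset_toMeasurable _ _
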